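/- Let $k$ be a field. For a commutative $k$-algebra $R$ let $\mathrm{t.d.}(R)$ denote its transcendence degree over $k$, that is, the supremum of the cardinalities of the subsets of $R$ that are algebraically independent over $k$ (it is $0$ for the zero ring), and let $\mathrm{ht}(I)$ denote the height of an ideal $I$. A $k$-algebra $A$ is called an AF-domain if it is an integral domain and $\mathrm{ht}(p)+\mathrm{t.d.}(A/p)=\mathrm{t.d.}(A)$ for every prime ideal $p$ of $A$. Let $A$ and $B$ be commutative $k$-algebras of finite transcendence degree over $k$, and assume that $A$ is an AF-domain. Let $P$ be a prime ideal of $A\otimes_k B$, and let $p=P\cap A$ and $q=P\cap B$ be its contractions along the canonical maps $A\to A\otimes_k B$ and $B\to A\otimes_k B$. Put $n=\mathrm{t.d.}(A)$ and let $q[n]=q[X_1,\dots,X_n]$ be the extension of $q$ to the polynomial ring $B[X_1,\dots,X_n]$. Let $p\otimes_k B+A\otimes_k q$ be the ideal of $A\otimes_k B$ generated by the images of $p$ and $q$. Then $$\mathrm{ht}(P)=\mathrm{ht}(q[n])+\mathrm{ht}(p)+\mathrm{ht}\left(\frac{P}{p\otimes_k B+A\otimes_k q}\right),$$ where the last height is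 taken in the quotient ring $(A\otimes_k B)/(p\otimes_k B+A\otimes_k q)$. -/

import Mathlib

open scoped TensorProduct

/-- A `k`-algebra `A` is an *AF-domain* (a domain satisfying the altitude formula over `k`) if it is
an integral domain and `ht(p) + t.d.(A/p) = t.d.(A)` for every prime ideal `p` of `A`, where `t.d.`
is the transcendence degree over `k`. The equation is read in `ℕ∞`. -/
structure IsAFDomain (k A : Type*) [Field k] [CommRing A] [Algebra k A] : Prop where
  isDomain : IsDomain A
  altitude_formula : ∀ p : Ideal A, p.IsPrime →
    p.height + Cardinal.toENat (Algebra.trdeg k (A ⧸ p)) = Cardinal.toENat (Algebra.trdeg k A)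

/-- The extension `q[n] = q[X₁, …, Xₙ]` of an ideal `q` of `B` to `B[X₁, …, Xₙ]`. -/
noncomputable def polyIdeal {B : Type*} [CommRing B] (q : Ideal B) (n : ℕ) :
    Ideal (MvPolynomial (Fin n) B) :=
  q.map (MvPolynomial.C : B →+* MvPolynomial (Fin n) B)

/-- The ideal `p ⊗ₖ B + A ⊗ₖ q` of `A ⊗ₖ B`. -/
noncomputable def tensorSumIdeal (k : Type*) {A B : Type*} [Field k] [CommRing A] [Algebra k A]
    [CommRing B] [Algebra k B] (p : Ideal A) (q : Ideal B) : Ideal (A ⊗[k] B) :=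
  p.map (Algebra.TensorProduct.includeLeft : A →ₐ[k] A ⊗[k] B) ⊔
    q.map (Algebra.TensorProduct.includeRight : B →ₐ[k] A ⊗[k] B)

/-! Write I = p ⊗ B + A ⊗ q, and t.d. for transcendence degree over k. Three inequalities in `ℕ∞`
carry the theorem: (1) ht q[n] + ht p + ht(P/I) ≤ ht P; (2) ht P + t.d.((A ⊗ B)/P) ≤ n + ht q[n] +
t.d.(B/q); (3) t.d.(B/q) + t.d.(A/p) ≤ ht(P/I) + t.d.((A ⊗ B)/P). The altitude formula enters only
through n = ht p + t.d.(A/p). Substituting this in (2), applying (3) and cancelling t.d.((A ⊗ B)/P)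
gives the reverse of (1).

For (2), the case of B[X₁, …, Xₙ] is an induction on the number of variables
(`MvPolynomial.heightBound`). Noether normalization makes A ⊗ B integral over such a ring when A is
finitely generated, and in general a finite chain of primes and a finite independent family are
already visible over a finitely generated subalgebra of A.

For (1) and (3), a family of n algebraically independent elements of a domain A embeds k[X₁, …, Xₙ]
in A. After passing to Frac A the map B[X₁, …, Xₙ] → A ⊗ B becomes flat, so going-down bounds below
the height of any prime over 0 ⊂ A (`MvPolynomial.height_comap_toTensor_le`). Inequality (3) applies
this to (A/p) ⊗ (B/q); inequality (1) stacks chains of primes. -/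

/-! ### Transcendence degree of quotients and polynomial rings. -/

section TranscendenceDegree

/-- The transcendence degree as an element of `ℕ∞`. -/
noncomputable def Algebra.etrdeg (k R : Type*) [CommRing k] [CommRing R] [Algebra k R] : ℕ∞ :=
  Cardinal.toENat (Algebra.trdeg k R)

variable {k : Type*} [Field k]

theorem Algebra.etrdeg_le_of_injective {R S : Type*} [CommRing R] [Algebra k R] [CommRing S]
    [Algebra k S] (f : R →ₐ[k] S) (hf : Function.Injective f) : etrdeg k R ≤ etrdeg k S := by
  have := OrderHomClass.mono Cardinal.toENat (lift_trdeg_le_of_injective f hf)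
  simpa [etrdeg] using this

theorem Algebra.etrdeg_le_of_surjective {R S : Type*} [CommRing R] [Algebra k R] [CommRing S]
    [Algebra k S] (f : R →ₐ[k] S) (hf : Function.Surjective f) : etrdeg k S ≤ etrdeg k R := by
  have := OrderHomClass.mono Cardinal.toENat (lift_trdeg_le_of_surjective f hf)
  simpa [etrdeg] using this

theorem AlgEquiv.etrdeg_eq {R S : Type*} [CommRing R] [Algebra k R] [CommRing S]
    [Algebra k S] (e : R ≃ₐ[k] S) : Algebra.etrdeg k R = Algebra.etrdeg k S :=
  le_antisymm (Algebra.etrdeg_le_of_injective e.toAlgHom e.injective)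
    (Algebra.etrdeg_le_of_surjective e.toAlgHom e.surjective)

theorem AlgebraicIndependent.natCast_le_etrdeg {R : Type*} [CommRing R] [Algebra k R]
    {ι : Type*} [Fintype ι] {x : ι → R} (hx : AlgebraicIndependent k x) :
    (Fintype.card ι : ℕ∞) ≤ Algebra.etrdeg k R := by
  have := OrderHomClass.mono Cardinal.toENat hx.lift_cardinalMk_le_trdeg
  simpa [Algebra.etrdeg] using this

theorem Algebra.natCast_le_etrdeg_iff {R : Type*} [CommRing R] [IsDomain R] [Algebra k R] {m : ℕ} :
    (m : ℕ∞) ≤ etrdeg k R ↔ ∃ x : Fin m → R, AlgebraicIndependent k x := by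
  refine ⟨fun h ↦ ?_, fun ⟨x, hx⟩ ↦ by simpa using hx.natCast_le_etrdeg⟩
  obtain ⟨s, hs⟩ := exists_isTranscendenceBasis k R
  rw [etrdeg, ← hs.cardinalMk_eq_trdeg, Cardinal.natCast_le_toENat] at h
  have h : Cardinal.lift (Cardinal.mk (Fin m)) ≤ Cardinal.lift (Cardinal.mk s) := by simpa using h
  rw [Cardinal.lift_mk_le'] at h
  obtain ⟨f⟩ := h
  exact ⟨_, hs.1.comp f f.injective⟩

/-- Lift an independent family from R/I and adjoin a nonzero a ∈ I. If a were algebraic over the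
subalgebra generated by the lifts, it would divide a nonzero element b of it; then b ∈ I is a
relation on the original family. -/
theorem Algebra.etrdeg_quotient_add_one_le {R : Type*} [CommRing R] [IsDomain R] [Algebra k R]
    (I : Ideal R) [I.IsPrime] (hI : I ≠ ⊥) : etrdeg k (R ⧸ I) + 1 ≤ etrdeg k R := by
  suffices h : ∀ m : ℕ, (m : ℕ∞) ≤ etrdeg k (R ⧸ I) → ((m + 1 : ℕ) : ℕ∞) ≤ etrdeg k R by
    rw [← ENat.forall_natCast_le_iff_le]
    intro a ha
    cases a with
    | zero => simp
    | succ m =>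
      refine h m ?_
      rw [Nat.cast_succ] at ha
      exact (ENat.add_le_add_iff_right ENat.one_ne_top).1 ha
  intro m hm
  obtain ⟨x, hx⟩ := natCast_le_etrdeg_iff.1 hm
  choose y hy using fun i ↦ Ideal.Quotient.mk_surjective (I := I) (x i)
  have hyx : (Ideal.Quotient.mkₐ k I) ∘ y = x := funext hy
  have hy_ind : AlgebraicIndependent k y := .of_comp (Ideal.Quotient.mkₐ k I) (hyx ▸ hx)
  obtain ⟨a, haI, ha0⟩ := Submodule.exists_mem_ne_zero_of_ne_bot hI
  have key : Transcendental (Algebra.adjoin k (Set.range y)) a := by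
    intro halg
    obtain ⟨b, hb0, hb⟩ := halg.exists_nonzero_dvd (mem_nonZeroDivisors_of_ne_zero ha0)
    have hbI : (b : R) ∈ I := Ideal.mem_of_dvd I hb haI
    obtain ⟨p, hp⟩ : ∃ p : MvPolynomial (Fin m) k, MvPolynomial.aeval y p = b := by
      simpa [Algebra.adjoin_range_eq_range_aeval] using b.2
    have hp0 : MvPolynomial.aeval x p = 0 := by
      have h := MvPolynomial.comp_aeval_apply (f := y) (Ideal.Quotient.mkₐ k I) p
      rw [hp] at h
      rw [← hyx]
      exact h.symm.trans (Ideal.Quotient.eq_zero_iff_mem.2 hbI)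
    have : p = 0 := hx (by simpa using hp0)
    apply hb0
    ext
    simp [← hp, this]
  have := ((hy_ind.option_iff_transcendental a).2 key).natCast_le_etrdeg
  simpa using this

theorem Ideal.etrdeg_quotient_add_one_le_of_lt {R : Type*} [CommRing R] [Algebra k R]
    {P Q : Ideal R} [P.IsPrime] [Q.IsPrime] (h : P < Q) :
    Algebra.etrdeg k (R ⧸ Q) + 1 ≤ Algebra.etrdeg k (R ⧸ P) := by
  have : (Q.map (Ideal.Quotient.mkₐ k P)).IsPrime :=
    Ideal.map_isPrime_of_surjective Ideal.Quotient.mk_surjective (by simpa using h.le)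
  rw [← (DoubleQuot.quotQuotEquivQuotOfLEₐ k h.le).etrdeg_eq]
  refine Algebra.etrdeg_quotient_add_one_le _ fun hbot ↦ h.not_ge ?_
  rw [Ideal.map_eq_bot_iff_le_ker] at hbot
  exact hbot.trans_eq (Ideal.Quotient.mkₐ_ker k P)

theorem Ideal.etrdeg_quotient_comap_le {R S : Type*} [CommRing R] [Algebra k R] [CommRing S]
    [Algebra k S] (f : R →ₐ[k] S) (P : Ideal S) :
    Algebra.etrdeg k (R ⧸ P.comap f) ≤ Algebra.etrdeg k (S ⧸ P) :=
  Algebra.etrdeg_le_of_injective (Ideal.quotientMapₐ P f le_rfl)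
    (Ideal.quotientMap_injective (I := P) (f := f.toRingHom))

theorem Algebra.etrdeg_eq_of_isIntegral {R S : Type*} [CommRing R] [Algebra k R] [CommRing S]
    [IsDomain S] [Algebra k S] (f : R →ₐ[k] S) (hf : Function.Injective f) (hi : f.IsIntegral) :
    etrdeg k R = etrdeg k S := by
  algebraize [f.toRingHom]
  have : FaithfulSMul R S := (faithfulSMul_iff_algebraMap_injective R S).2 hf
  have : IsScalarTower k R S := .of_algebraMap_eq fun x ↦ (f.commutes x).symm
  have : IsDomain R := hf.isDomain f.toRingHom
  have h := lift_trdeg_add_eq k R S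
  rw [trdeg_eq_zero (R := R) (A := S)] at h
  simpa [etrdeg] using congrArg Cardinal.toENat h

theorem Ideal.etrdeg_quotient_comap_eq_of_isIntegral {R S : Type*} [CommRing R] [Algebra k R]
    [CommRing S] [Algebra k S] (f : R →ₐ[k] S) (hf : f.IsIntegral) (P : Ideal S) [P.IsPrime] :
    Algebra.etrdeg k (R ⧸ P.comap f) = Algebra.etrdeg k (S ⧸ P) :=
  Algebra.etrdeg_eq_of_isIntegral (Ideal.quotientMapₐ P f le_rfl)
    (Ideal.quotientMap_injective (I := P) (f := f.toRingHom))
    (RingHom.IsIntegral.quotient (f := f.toRingHom) hf)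

theorem Polynomial.etrdeg_eq {R : Type*} [CommRing R] [IsDomain R] [Algebra k R] :
    Algebra.etrdeg k (Polynomial R) = Algebra.etrdeg k R + 1 := by
  have := trdeg_add_eq k R (A := Polynomial R)
  rw [Polynomial.trdeg_of_isDomain] at this
  simp [Algebra.etrdeg, ← this]

theorem Ideal.etrdeg_quotient_map_polynomial {R : Type*} [CommRing R] [Algebra k R]
    (P : Ideal R) [P.IsPrime] :
    Algebra.etrdeg k (Polynomial R ⧸ P.map (Polynomial.C : R →+* Polynomial R)) =
      Algebra.etrdeg k (R ⧸ P) + 1 := by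
  rw [← Polynomial.etrdeg_eq]
  refine (AlgEquiv.etrdeg_eq (AlgEquiv.ofRingEquiv
    (f := Ideal.polynomialQuotientEquivQuotientPolynomial P) fun x ↦ ?_)).symm
  rw [IsScalarTower.algebraMap_apply k (R ⧸ P) (Polynomial (R ⧸ P)), Polynomial.algebraMap_eq,
    IsScalarTower.algebraMap_apply k R (R ⧸ P), Ideal.Quotient.algebraMap_eq]
  have := Ideal.polynomialQuotientEquivQuotientPolynomial_map_mk P
    (Polynomial.C (algebraMap k R x))
  rw [Polynomial.map_C] at this
  rw [this]
  rfl

end TranscendenceDegree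

/-! ### Chains of primes under surjective, integral and flat maps. -/

section Height

theorem Ideal.natCast_add_one_le_height_iff {R : Type*} [CommRing R] {P : Ideal R} [P.IsPrime]
    {n : ℕ} : ((n + 1 : ℕ) : ℕ∞) ≤ P.height ↔
      ∃ P' : Ideal R, P'.IsPrime ∧ P' < P ∧ (n : ℕ∞) ≤ P'.height := by
  rw [Nat.cast_add_one, ENat.add_one_le_iff (ENat.natCast_ne_top n), ← not_le, Ideal.height_le_iff]
  push Not
  rfl

theorem ENat.add_le_of_forall_natCast {a c d : ℕ∞}
    (h : ∀ n : ℕ, (n : ℕ∞) ≤ a → c + n ≤ d) : c + a ≤ d := by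
  induction a with
  | top =>
    have : ∀ n : ℕ, (n : ℕ∞) ≤ d := fun n ↦ le_add_self.trans (h n le_top)
    rw [ENat.eq_top_iff_forall_ge.2 this]
    exact le_top
  | coe n => exact h n le_rfl

theorem Ideal.comap_map_eq_of_ker_le {R S : Type*} [CommRing R] [CommRing S] {f : R →+* S}
    (hf : Function.Surjective f) {P : Ideal R} (hP : RingHom.ker f ≤ P) :
    (P.map f).comap f = P := by
  rw [Ideal.comap_map_of_surjective _ hf, ← RingHom.ker_eq_comap_bot, sup_eq_left.2 hP]

/-- A chain below the image of P pulls back to a chain below P whose least member M contains the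
kernel; a chain of length c below M extends it downwards. -/
theorem Ideal.add_height_map_le_of_surjective {R S : Type*} [CommRing R] [CommRing S] {f : R →+* S}
    (hf : Function.Surjective f) {P : Ideal R} [P.IsPrime] (hP : RingHom.ker f ≤ P) {c : ℕ∞}
    (hc : ∀ M : Ideal R, M.IsPrime → RingHom.ker f ≤ M → M ≤ P → c ≤ M.height) :
    c + (P.map f).height ≤ P.height := by
  refine ENat.add_le_of_forall_natCast fun n hn ↦ ?_
  induction n generalizing P with
  | zero => simpa using hc P ‹_› hP le_rfl
  | succ n ih =>
    have : (P.map f).IsPrime := Ideal.map_isPrime_of_surjective hf hP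
    obtain ⟨Q, hQ, hlt, hnQ⟩ := Ideal.natCast_add_one_le_height_iff.1 hn
    have hlt' : Q.comap f < P := by
      rw [← Ideal.comap_map_eq_of_ker_le hf hP]
      exact lt_of_le_of_ne (Ideal.comap_mono hlt.le) fun he ↦ hlt.ne
        (Ideal.comap_injective_of_surjective _ hf he)
    have := ih (Ideal.ker_le_comap f) (fun M hM h1 h2 ↦ hc M hM h1 (h2.trans hlt'.le))
      (by rwa [Ideal.map_comap_of_surjective _ hf])
    rw [Nat.cast_add_one, ← add_assoc]
    exact (add_le_add_left this 1).trans (Ideal.height_add_one_le_of_lt_of_isPrime hlt')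

theorem Ideal.height_map_quotient_mk_ker {R S : Type*} [CommRing R] [CommRing S] {f : R →+* S}
    (hf : Function.Surjective f) (P : Ideal R) :
    (P.map (Ideal.Quotient.mk (RingHom.ker f))).height = (P.map f).height := by
  let e := RingHom.quotientKerEquivOfSurjective hf
  have h : (e : R ⧸ RingHom.ker f →+* S).comp (Ideal.Quotient.mk (RingHom.ker f)) = f := by
    ext x
    exact RingHom.quotientKerEquivOfSurjective_apply_mk hf x
  have h1 := RingEquiv.height_map e (P.map (Ideal.Quotient.mk (RingHom.ker f)))
  have h2 := Ideal.map_map (I := P) (Ideal.Quotient.mk (RingHom.ker f))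
    (e : R ⧸ RingHom.ker f →+* S)
  rw [h] at h2
  rw [← h1, ← h2]
  rfl

/-- By incomparability, strict chains stay strict after contraction. -/
theorem Ideal.height_le_height_comap_of_isIntegral {R S : Type*} [CommRing R] [CommRing S]
    (f : R →+* S) (hf : f.IsIntegral) (P : Ideal S) [P.IsPrime] :
    P.height ≤ (P.comap f).height := by
  algebraize [f]
  refine ENat.forall_natCast_le_iff_le.1 fun n hn ↦ ?_
  induction n generalizing P with
  | zero => simp
  | succ n ih =>
    obtain ⟨Q, hQ, hlt, hnQ⟩ := Ideal.natCast_add_one_le_height_iff.1 hn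
    exact Ideal.natCast_add_one_le_height_iff.2
      ⟨_, inferInstance, Ideal.IsIntegral.comap_lt_comap (R := R) hlt, ih Q hnQ⟩

theorem Ideal.height_le_height_of_hasGoingDown {R S : Type*} [CommRing R] [CommRing S]
    [Algebra R S] [Algebra.HasGoingDown R S] (p : Ideal R) [p.IsPrime] (P : Ideal S) [P.IsPrime]
    [P.LiesOver p] : p.height ≤ P.height := by
  refine ENat.forall_natCast_le_iff_le.1 fun n hn ↦ ?_
  induction n generalizing P p with
  | zero => simp
  | succ n ih =>
    obtain ⟨q, hq, hlt, hnq⟩ := Ideal.natCast_add_one_le_height_iff.1 hn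
    obtain ⟨Q, hQP, hQ, _⟩ := Ideal.exists_ideal_lt_liesOver_of_lt P hlt
    exact Ideal.natCast_add_one_le_height_iff.2 ⟨Q, hQ, hQP, ih q Q hnq⟩

theorem RingHom.Flat.height_comap_le {R S : Type*} [CommRing R] [CommRing S] {f : R →+* S}
    (hf : f.Flat) (P : Ideal S) [P.IsPrime] : (P.comap f).height ≤ P.height := by
  algebraize [f]
  have : P.LiesOver (P.comap f) := ⟨rfl⟩
  exact Ideal.height_le_height_of_hasGoingDown _ P

end Height

/-! ### Primes of R[X] over a given prime of R. -/

section OneVariable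

open Polynomial

variable {R : Type*} [CommRing R]

theorem Polynomial.comap_C_map_C (p : Ideal R) : (p.map (C : R →+* R[X])).comap C = p := by
  refine le_antisymm (fun a ha ↦ ?_) Ideal.le_comap_map
  simpa using (Ideal.mem_map_C_iff.1 (Ideal.mem_comap.1 ha)) 0

theorem Polynomial.height_le_height_map_C (p : Ideal R) [p.IsPrime] :
    p.height ≤ (p.map (C : R →+* R[X])).height := by
  have : (p.map (C : R →+* R[X])).LiesOver p := ⟨(comap_C_map_C p).symm⟩
  exact Ideal.height_le_height_of_hasGoingDown p _

/-- There is no chain of three distinct primes of `R[X]` with the same contraction to `R`. -/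
theorem Polynomial.eq_of_lt_of_comap_C_eq {p : Ideal R} [p.IsPrime] {N N' : Ideal R[X]} [N.IsPrime]
    [N'.IsPrime] (hlt : N' < N) (hN : N.comap C = p) (hN' : N'.comap C = p) :
    N' = p.map C := by
  by_contra hne
  have hlt' : p.map C < N' :=
    lt_of_le_of_ne (Ideal.map_le_iff_le_comap.2 hN'.ge) (Ne.symm hne)
  let x : PrimeSpectrum R := ⟨p, ‹_›⟩
  let T := PrimeSpectrum.comap (algebraMap R R[X]) ⁻¹' {x}
  let a : T := ⟨⟨p.map C, inferInstance⟩, PrimeSpectrum.ext (comap_C_map_C p)⟩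
  let b : T := ⟨⟨N', inferInstance⟩, PrimeSpectrum.ext hN'⟩
  let c : T := ⟨⟨N, inferInstance⟩, PrimeSpectrum.ext hN⟩
  have hab : a < b := hlt'
  have hbc : b < c := hlt
  -- The fibre over p is the spectrum of κ(p)[X], a polynomial ring over a field.
  have hdim : Order.krullDim T ≤ 1 := by
    rw [Order.krullDim_eq_of_orderIso (PrimeSpectrum.preimageOrderIsoFiber R R[X] x),
      ← ringKrullDim, ← ringKrullDim_eq_of_ringEquiv
      (polyEquivTensor R x.asIdeal.ResidueField).toRingEquiv]
    exact Ring.krullDimLE_iff.1 inferInstance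
  let s : LTSeries T := ⟨2, ![a, b, c], fun i ↦ by fin_cases i; exacts [hab, hbc]⟩
  have := (Order.LTSeries.length_le_krullDim s).trans hdim
  have h2 : s.length = 2 := rfl
  rw [h2] at this
  exact absurd this (by decide)

/-- A prime of `R[X]` lying over `p` has height at most `ht(p[X]) + 1`. -/
theorem Polynomial.height_le_height_map_C_add_one (N : Ideal R[X]) [N.IsPrime] :
    N.height ≤ ((N.comap C).map (C : R →+* R[X])).height + 1 := by
  suffices h : ∀ n : ℕ, ∀ N : Ideal R[X], N.IsPrime → ((n + 1 : ℕ) : ℕ∞) ≤ N.height →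
      (n : ℕ∞) ≤ ((N.comap C).map (C : R →+* R[X])).height by
    rw [← ENat.forall_natCast_le_iff_le]
    intro a ha
    cases a with
    | zero => simp
    | succ n =>
      rw [Nat.cast_add_one]
      exact add_le_add_left (h n N ‹_› ha) 1
  intro n
  induction n with
  | zero => simp
  | succ n ih =>
    intro N hN hn
    obtain ⟨N', hN', hlt, hnN'⟩ := Ideal.natCast_add_one_le_height_iff.1 hn
    by_cases h : N'.comap C = N.comap C
    · rwa [← Polynomial.eq_of_lt_of_comap_C_eq hlt rfl h]
    · refine Ideal.natCast_add_one_le_height_iff.2 ⟨(N'.comap C).map C, inferInstance, ?_,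
        ih N' hN' hnN'⟩
      refine lt_of_le_of_ne (Ideal.map_mono (Ideal.comap_mono hlt.le)) fun he ↦ h ?_
      rw [← comap_C_map_C (N'.comap C), he, comap_C_map_C]

end OneVariable

/-! ### Height and transcendence degree in B[X₁, …, Xₙ]. -/

section PolynomialRing

open Polynomial Algebra

universe u

/-- Primes `Q` of the `B`-algebra `T` satisfy `ht(Q) + t.d.(T/Q) ≤ n + ht(qT) + t.d.(B/q)`, where
`q = Q ∩ B`. -/
def HeightBound (k B T : Type*) [Field k] [CommRing B] [Algebra k B] [CommRing T] [Algebra B T]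
    [Algebra k T] (n : ℕ) : Prop :=
  ∀ Q : Ideal T, Q.IsPrime → Q.height + etrdeg k (T ⧸ Q) ≤
    n + ((Q.comap (algebraMap B T)).map (algebraMap B T)).height +
      etrdeg k (B ⧸ Q.comap (algebraMap B T))

variable {k : Type*} [Field k]

theorem Ideal.etrdeg_quotient_comap_algEquiv {R S : Type*} [CommRing R] [Algebra k R]
    [CommRing S] [Algebra k S] (e : R ≃ₐ[k] S) (P : Ideal S) [P.IsPrime] :
    etrdeg k (R ⧸ P.comap e) = etrdeg k (S ⧸ P) :=
  Ideal.etrdeg_quotient_comap_eq_of_isIntegral e.toAlgHom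
    (RingHom.isIntegral_of_surjective _ e.surjective) P

theorem Ideal.height_map_algebraMap_of_algEquiv {B T T' : Type*} [CommRing B] [CommRing T]
    [Algebra B T] [CommRing T'] [Algebra B T'] (e : T ≃ₐ[B] T') (I : Ideal B) :
    (I.map (algebraMap B T)).height = (I.map (algebraMap B T')).height := by
  rw [← RingEquiv.height_map e.toRingEquiv (I.map (algebraMap B T))]
  change ((I.map (algebraMap B T)).map (e.toRingEquiv : T →+* T')).height = _
  rw [Ideal.map_map]
  congr 2
  ext b
  exact e.commutes b

theorem HeightBound.of_algEquiv {B T T' : Type*} [CommRing B] [Algebra k B] [CommRing T]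
    [Algebra B T] [Algebra k T] [IsScalarTower k B T] [CommRing T'] [Algebra B T'] [Algebra k T']
    [IsScalarTower k B T'] {n : ℕ} (h : HeightBound k B T n) (e : T ≃ₐ[B] T') :
    HeightBound k B T' n := by
  intro Q hQ
  have h1 := h (Q.comap e) inferInstance
  have hc : (Q.comap e).comap (algebraMap B T) = Q.comap (algebraMap B T') := by
    ext b
    simp
  rw [hc, Ideal.height_map_algebraMap_of_algEquiv e] at h1
  have h2 : (Q.comap e).height = Q.height := RingEquiv.height_comap e.toRingEquiv Q
  have h3 : etrdeg k (T ⧸ Q.comap e) = etrdeg k (T' ⧸ Q) :=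
    Ideal.etrdeg_quotient_comap_algEquiv (e.restrictScalars k) Q
  rwa [h2, h3] at h1

/-- Moving the variable of the outer polynomial ring into the coefficients. -/
noncomputable def MvPolynomial.polynomialCommAlgEquiv (B : Type*) [CommRing B] (n : ℕ) :
    (MvPolynomial (Fin n) B)[X] ≃ₐ[B] MvPolynomial (Fin n) B[X] :=
  (optionEquivLeft B (Fin n)).symm.trans (optionEquivRight B (Fin n))

theorem MvPolynomial.polynomialCommAlgEquiv_map_C {B : Type*} [CommRing B] {n : ℕ} (f : B[X]) :
    polynomialCommAlgEquiv B n (f.map MvPolynomial.C) = MvPolynomial.C f := by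
  have : ((polynomialCommAlgEquiv B n : _ →+* _).comp
      (Polynomial.mapRingHom (MvPolynomial.C : B →+* MvPolynomial (Fin n) B))) =
      (MvPolynomial.C : B[X] →+* MvPolynomial (Fin n) B[X]) := by
    ext
    · simp [polynomialCommAlgEquiv]
    · simp [polynomialCommAlgEquiv]
  exact DFunLike.congr_fun this f

/-- The hypothesis is over B[X] because an extended prime, seen in B[X][X₁, …, Xₙ], contracts to
q[X], whose residue ring has transcendence degree t.d.(B/q) + 1. This supplies the extra variable
without altering the height term. -/
theorem HeightBound.polynomial {B : Type u} [CommRing B] [Algebra k B] {n : ℕ}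
    (h : HeightBound k B[X] (MvPolynomial (Fin n) B[X]) n) :
    HeightBound k B (MvPolynomial (Fin n) B)[X] (n + 1) := by
  have ext_case (N : Ideal (MvPolynomial (Fin n) B)) (hN : N.IsPrime) :
      (N.map (C : _ →+* (MvPolynomial (Fin n) B)[X])).height +
        etrdeg k ((MvPolynomial (Fin n) B)[X] ⧸ N.map (C : _ →+* (MvPolynomial (Fin n) B)[X])) ≤
      (n + 1 : ℕ) + ((N.comap (MvPolynomial.C)).map
        (algebraMap B (MvPolynomial (Fin n) B)[X])).height + 
        etrdeg k (B ⧸ N.comap (MvPolynomial.C)) := by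
    set e := MvPolynomial.polynomialCommAlgEquiv B n
    set M := N.map (C : _ →+* (MvPolynomial (Fin n) B)[X]) with hM
    have hMp : M.IsPrime := inferInstance
    have h1 := h (M.comap e.symm) inferInstance
    have h2 : (M.comap e.symm).height = M.height := RingEquiv.height_comap e.symm.toRingEquiv M
    have h3 : etrdeg k (_ ⧸ M.comap e.symm) = etrdeg k (_ ⧸ M) :=
      Ideal.etrdeg_quotient_comap_algEquiv (e.symm.restrictScalars k) M
    have h4 : (M.comap e.symm).comap (algebraMap B[X] (MvPolynomial (Fin n) B[X])) =
        (N.comap MvPolynomial.C).map C := by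
      ext f
      rw [Ideal.mem_comap, Ideal.mem_comap, MvPolynomial.algebraMap_eq,
        ← MvPolynomial.polynomialCommAlgEquiv_map_C, AlgEquiv.symm_apply_apply, hM,
        Ideal.mem_map_C_iff, Ideal.mem_map_C_iff]
      simp
    rw [h2, h3, h4, Ideal.etrdeg_quotient_map_polynomial (N.comap MvPolynomial.C), Ideal.map_map] at h1
    have h5 := Ideal.height_map_algebraMap_of_algEquiv e (N.comap MvPolynomial.C)
    rw [IsScalarTower.algebraMap_eq B B[X] (MvPolynomial (Fin n) B[X])] at h5
    rw [← Polynomial.algebraMap_eq, ← h5] at h1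
    refine h1.trans_eq ?_
    push_cast
    ring
  intro N hN
  have hc : N.comap (algebraMap B (MvPolynomial (Fin n) B)[X]) =
    (N.comap C).comap MvPolynomial.C := rfl
  have h1 := ext_case (N.comap C) inferInstance
  rw [hc]
  by_cases hNe : N = (N.comap C).map C
  · rwa [← hNe] at h1
  -- Compared with the extended prime below it, N gains at most 1 in height and loses at least 1 in
  -- residue transcendence degree.
  · refine le_trans ?_ h1
    have hlt : (N.comap C).map C < N := lt_of_le_of_ne Ideal.map_comap_le (Ne.symm hNe)
    calc N.height + etrdeg k (_ ⧸ N) ≤ ((N.comap C).map C).height + 1 + etrdeg k (_ ⧸ N) := by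
          gcongr
          exact height_le_height_map_C_add_one N
      _ = ((N.comap C).map C).height + (etrdeg k (_ ⧸ N) + 1) := by ring
      _ ≤ _ := by
          gcongr
          exact Ideal.etrdeg_quotient_add_one_le_of_lt hlt

theorem MvPolynomial.heightBound (n : ℕ) (B : Type u) [CommRing B] [Algebra k B] :
    HeightBound k B (MvPolynomial (Fin n) B) n := by
  induction n generalizing B with
  | zero =>
    suffices h : HeightBound k B B 0 from h.of_algEquiv (isEmptyAlgEquiv B (Fin 0)).symm
    intro Q hQ
    have hQ' : Q.comap (algebraMap B B) = Q := Ideal.comap_id Q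
    have hQ2 : Q.map (algebraMap B B) = Q := Ideal.map_id Q
    rw [hQ', hQ2]
    simp
  | succ n ih => exact (ih B[X]).polynomial.of_algEquiv (finSuccEquiv B n).symm

/-- Each variable contributes 1: to the residue transcendence degree if the prime is extended from
one variable fewer, to the height otherwise. -/
theorem MvPolynomial.add_etrdeg_le_height_add (n : ℕ) {B : Type*} [CommRing B] [Algebra k B]
    (Q : Ideal (MvPolynomial (Fin n) B)) [Q.IsPrime] :
    n + etrdeg k (B ⧸ Q.comap (C : B →+* MvPolynomial (Fin n) B)) ≤
      Q.height + etrdeg k (_ ⧸ Q) := by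
  induction n with
  | zero =>
    refine (zero_add _).trans_le (le_add_left ?_)
    exact Ideal.etrdeg_quotient_comap_le (IsScalarTower.toAlgHom k B (MvPolynomial (Fin 0) B)) Q
  | succ n ih =>
    let e := finSuccEquiv B n
    let N := Q.comap e.symm
    let N₁ := N.comap Polynomial.C
    have h2 : N.height = Q.height := RingEquiv.height_comap e.symm.toRingEquiv Q
    have h3 : etrdeg k (_ ⧸ N) = etrdeg k (_ ⧸ Q) :=
      Ideal.etrdeg_quotient_comap_algEquiv (e.symm.restrictScalars k) Q
    have hc : N₁.comap C = Q.comap C := by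
      ext b
      exact iff_of_eq (congrArg (· ∈ Q) (e.symm.commutes b))
    have h1 := ih N₁
    rw [hc] at h1
    rw [← h2, ← h3]
    have h4 : N₁.height ≤ (N₁.map Polynomial.C).height := height_le_height_map_C N₁
    rw [Nat.cast_add_one, add_right_comm]
    by_cases hNe : N = N₁.map Polynomial.C
    · rw [hNe, Ideal.etrdeg_quotient_map_polynomial, ← add_assoc]
      exact add_le_add_left (h1.trans (add_le_add_left h4 _)) 1
    · have hlt : N₁.map Polynomial.C < N := lt_of_le_of_ne Ideal.map_comap_le (Ne.symm hNe)
      calc _ ≤ N₁.height + etrdeg k (_ ⧸ N₁) + 1 := by gcongr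
        _ ≤ (N₁.map Polynomial.C).height + etrdeg k (_ ⧸ N₁) + 1 := by gcongr
        _ = (N₁.map Polynomial.C).height + 1 + etrdeg k (_ ⧸ N₁) := by ring
        _ ≤ _ := by
          gcongr
          · exact Ideal.height_add_one_le_of_lt_of_isPrime hlt
          · exact Ideal.etrdeg_quotient_comap_le (IsScalarTower.toAlgHom k
              (MvPolynomial (Fin n) B) (MvPolynomial (Fin n) B)[X]) N

end PolynomialRing

/-! ### Upper bound for ht P + t.d.((A ⊗ B)/P). -/

section UpperBound

variable {k : Type*} [Field k]

theorem isPrime_polyIdeal {B : Type*} [CommRing B] (q : Ideal B) [q.IsPrime] (n : ℕ) :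
    (polyIdeal q n).IsPrime := by
  rw [polyIdeal, ← Ideal.Quotient.isDomain_iff_prime]
  exact (MvPolynomial.quotientEquivQuotientMvPolynomial q).symm.toMulEquiv.isDomain _

theorem monotone_height_polyIdeal {B : Type*} [CommRing B] (q : Ideal B) [q.IsPrime] :
    Monotone fun n ↦ (polyIdeal q n).height := by
  refine monotone_nat_of_le_succ fun n ↦ ?_
  have := isPrime_polyIdeal q n
  refine (Polynomial.height_le_height_map_C _).trans_eq ?_
  rw [polyIdeal, Ideal.map_map]
  exact Ideal.height_map_algebraMap_of_algEquiv (MvPolynomial.finSuccEquiv B n).symm q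

/-- The isomorphism `B[X₁, …, Xₙ] ≃ k[X₁, …, Xₙ] ⊗ B`. -/
noncomputable def MvPolynomial.tensorAlgEquiv (k B : Type*) [Field k] [CommRing B] [Algebra k B]
    (n : ℕ) : MvPolynomial (Fin n) B ≃ₐ[k] MvPolynomial (Fin n) k ⊗[k] B :=
  ((algebraTensorAlgEquiv (σ := Fin n) k B).restrictScalars k).symm.trans
    (Algebra.TensorProduct.comm k B (MvPolynomial (Fin n) k))

/-- The map `B[X₁, …, Xₙ] → A ⊗ B` induced by a `k`-algebra map `g : k[X₁, …, Xₙ] → A`. -/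
noncomputable def MvPolynomial.toTensor {A : Type*} (B : Type*) [CommRing A] [Algebra k A]
    [CommRing B] [Algebra k B] {n : ℕ} (g : MvPolynomial (Fin n) k →ₐ[k] A) :
    MvPolynomial (Fin n) B →ₐ[k] A ⊗[k] B :=
  (Algebra.TensorProduct.map g (AlgHom.id k B)).comp (tensorAlgEquiv k B n).toAlgHom

namespace MvPolynomial

variable {A B : Type*} [CommRing A] [Algebra k A] [CommRing B] [Algebra k B] {n : ℕ}
  (g : MvPolynomial (Fin n) k →ₐ[k] A)

theorem toTensor_C (b : B) : toTensor B g (C b) = 1 ⊗ₜ b := by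
  have : (algebraTensorAlgEquiv k B).symm (C b : MvPolynomial (Fin n) B) = b ⊗ₜ 1 :=
    algebraTensorAlgEquiv_symm_monomial k B 0 b
  simp [toTensor, tensorAlgEquiv, this]

theorem comap_toTensor_comap_C (P : Ideal (A ⊗[k] B)) :
    (P.comap (toTensor B g)).comap (C : B →+* MvPolynomial (Fin n) B) =
      P.comap (Algebra.TensorProduct.includeRight : B →ₐ[k] A ⊗[k] B) := by
  ext b
  simp [Ideal.mem_comap, toTensor_C]

theorem isIntegral_toTensor (hg : g.IsIntegral) : (toTensor B g).IsIntegral := by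
  refine RingHom.IsIntegral.trans _ _ (RingHom.isIntegral_of_surjective _ (tensorAlgEquiv k B n).surjective) ?_
  intro z
  induction z with
  | zero => exact RingHom.isIntegralElem_zero _
  | add x y hx hy => exact RingHom.IsIntegralElem.add _ hx hy
  | tmul a b =>
    have h1 : a ⊗ₜ[k] b = (a ⊗ₜ 1) * (1 ⊗ₜ b) := by simp
    rw [h1]
    refine RingHom.IsIntegralElem.mul _ ?_ ?_
    · obtain ⟨p, hp, hpa⟩ := hg a
      refine ⟨p.map (Algebra.TensorProduct.includeLeft :
        MvPolynomial (Fin n) k →ₐ[k] MvPolynomial (Fin n) k ⊗[k] B).toRingHom, hp.map _, ?_⟩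
      have := congrArg (Algebra.TensorProduct.includeLeft : A →ₐ[k] A ⊗[k] B) hpa
      rw [map_zero] at this
      rw [Polynomial.eval₂_map, ← this]
      have h2 := Polynomial.hom_eval₂ p g.toRingHom
        (Algebra.TensorProduct.includeLeft : A →ₐ[k] A ⊗[k] B).toRingHom a
      refine Eq.trans ?_ h2.symm
      congr 1
    · have : (1 : A) ⊗ₜ[k] b = Algebra.TensorProduct.map g (AlgHom.id k B) (1 ⊗ₜ b) := by simp
      rw [this]
      exact RingHom.isIntegralElem_map _

theorem flat_toTensor (hg : g.Flat) : (toTensor B g).Flat := by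
  refine RingHom.Flat.comp (RingHom.Flat.of_bijective (tensorAlgEquiv k B n).bijective) ?_
  exact RingHom.Flat.tensorProductMap hg (RingHom.Flat.id B)

end MvPolynomial

variable {A B : Type*} [CommRing A] [Algebra k A] [CommRing B] [Algebra k B]

/-- Noether normalization gives d ≤ n variables; contraction along the integral map from B[X₁, …,
X_d] keeps the residue transcendence degree and does not lower the height. -/
theorem Algebra.TensorProduct.height_add_etrdeg_le_of_finiteType [Algebra.FiniteType k A]
    (P : Ideal (A ⊗[k] B)) [P.IsPrime] {n : ℕ} (hn : Algebra.etrdeg k A ≤ n) :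
    P.height + Algebra.etrdeg k (_ ⧸ P) ≤
      n + (polyIdeal (P.comap (Algebra.TensorProduct.includeRight : B →ₐ[k] A ⊗[k] B)) n).height +
        Algebra.etrdeg k (B ⧸ P.comap (Algebra.TensorProduct.includeRight : B →ₐ[k] A ⊗[k] B)) := by
  have : Nontrivial A := by
    by_contra h
    rw [not_nontrivial_iff_subsingleton] at h
    have : Subsingleton (A ⊗[k] B) := Module.subsingleton A _
    exact ‹P.IsPrime›.ne_top (Subsingleton.elim _ _)
  obtain ⟨d, g, hg, hgi⟩ := exists_integral_inj_algHom_of_fg k A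
  have hd : d ≤ n := by
    have h : AlgebraicIndependent k (g ∘ MvPolynomial.X) := by
      have : MvPolynomial.aeval (g ∘ MvPolynomial.X) = g := by ext; simp
      rw [AlgebraicIndependent, this]
      exact hg
    have := h.natCast_le_etrdeg.trans hn
    simpa using this
  have hi := MvPolynomial.isIntegral_toTensor (B := B) g hgi
  set q := P.comap (Algebra.TensorProduct.includeRight : B →ₐ[k] A ⊗[k] B) with hq
  have hb := MvPolynomial.heightBound (k := k) d B (P.comap (MvPolynomial.toTensor B g))
    inferInstance
  rw [MvPolynomial.algebraMap_eq, MvPolynomial.comap_toTensor_comap_C, ← hq,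
    Ideal.etrdeg_quotient_comap_eq_of_isIntegral _ hi] at hb
  calc _ ≤ _ := add_le_add_left (Ideal.height_le_height_comap_of_isIntegral _ hi P) _
    _ ≤ _ := hb
    _ ≤ _ := by
      have := monotone_height_polyIdeal q hd
      gcongr
      exact this

/-- Asking for every S' above S lets finitely many such choices be merged by a supremum. -/
theorem Algebra.TensorProduct.exists_fg_forall_mem_range (z : A ⊗[k] B) :
    ∃ S : Subalgebra k A, S.FG ∧ ∀ S' : Subalgebra k A, S ≤ S' →
      z ∈ Set.range (Algebra.TensorProduct.map S'.val (AlgHom.id k B)) := by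
  induction z with
  | zero => exact ⟨⊥, Subalgebra.fg_bot, fun S' _ ↦ ⟨0, map_zero _⟩⟩
  | tmul a b =>
    refine ⟨Algebra.adjoin k {a}, ⟨{a}, by simp⟩, fun S' hS ↦ ⟨⟨a, hS ?_⟩ ⊗ₜ b, by simp⟩⟩
    exact Algebra.self_mem_adjoin_singleton k a
  | add x y hx hy =>
    obtain ⟨S, hS, hx⟩ := hx
    obtain ⟨T, hT, hy⟩ := hy
    refine ⟨S ⊔ T, hS.sup hT, fun S' hS' ↦ ?_⟩
    obtain ⟨x, rfl⟩ := hx S' (le_sup_left.trans hS')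
    obtain ⟨y, rfl⟩ := hy S' (le_sup_right.trans hS')
    exact ⟨x + y, map_add _ _ _⟩

/-- A chain stays strict over S' once S' captures an element separating each consecutive pair. -/
theorem Algebra.TensorProduct.exists_fg_forall_le_height_comap (P : Ideal (A ⊗[k] B)) [P.IsPrime] {n : ℕ}
    (hn : (n : ℕ∞) ≤ P.height) :
    ∃ S : Subalgebra k A, S.FG ∧ ∀ S' : Subalgebra k A, S ≤ S' →
      (n : ℕ∞) ≤ (P.comap (Algebra.TensorProduct.map S'.val (AlgHom.id k B))).height := by
  induction n generalizing P with
  | zero => exact ⟨⊥, Subalgebra.fg_bot, fun S' _ ↦ by simp⟩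
  | succ n ih =>
    obtain ⟨P', hP', hlt, hnP'⟩ := Ideal.natCast_add_one_le_height_iff.1 hn
    obtain ⟨S, hS, hSP⟩ := ih P' hnP'
    obtain ⟨z, hzP, hzP'⟩ := SetLike.exists_of_lt hlt
    obtain ⟨T, hT, hTz⟩ := Algebra.TensorProduct.exists_fg_forall_mem_range z
    refine ⟨S ⊔ T, hS.sup hT, fun S' hS' ↦ ?_⟩
    obtain ⟨w, hw⟩ := hTz S' (le_sup_right.trans hS')
    refine Ideal.natCast_add_one_le_height_iff.2 ⟨_, inferInstance, ?_,
      hSP S' (le_sup_left.trans hS')⟩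
    refine lt_of_le_of_ne (Ideal.comap_mono hlt.le) fun he ↦ hzP' ?_
    have : w ∈ P.comap (Algebra.TensorProduct.map S'.val (AlgHom.id k B)) := by
      rw [Ideal.mem_comap, hw]
      exact hzP
    rw [← he, Ideal.mem_comap, hw] at this
    exact this

theorem Algebra.TensorProduct.exists_fg_forall_le_etrdeg_comap (P : Ideal (A ⊗[k] B)) [P.IsPrime] {n : ℕ}
    (hn : (n : ℕ∞) ≤ Algebra.etrdeg k (_ ⧸ P)) :
    ∃ S : Subalgebra k A, S.FG ∧ ∀ S' : Subalgebra k A, S ≤ S' →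
      (n : ℕ∞) ≤ Algebra.etrdeg k (_ ⧸ P.comap (Algebra.TensorProduct.map S'.val (AlgHom.id k B))) := by
  obtain ⟨x, hx⟩ := natCast_le_etrdeg_iff.1 hn
  choose y hy using fun i ↦ Ideal.Quotient.mk_surjective (I := P) (x i)
  choose S hS hSy using fun i ↦ Algebra.TensorProduct.exists_fg_forall_mem_range (y i)
  refine ⟨Finset.univ.sup S, Finset.sup_induction Subalgebra.fg_bot (fun _ h _ h' ↦ h.sup h')
    fun i _ ↦ hS i, fun S' hS' ↦ ?_⟩
  choose w hw using fun i ↦ hSy i S' ((Finset.le_sup (Finset.mem_univ i)).trans hS')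
  refine natCast_le_etrdeg_iff.2 ⟨fun i ↦ Ideal.Quotient.mk _ (w i), ?_⟩
  refine .of_comp (Ideal.quotientMapₐ P (Algebra.TensorProduct.map S'.val (AlgHom.id k B)) le_rfl) ?_
  convert! hx using 1
  ext i
  simp [← hy, ← hw]

theorem Algebra.TensorProduct.height_add_etrdeg_le (P : Ideal (A ⊗[k] B)) [P.IsPrime] {n : ℕ}
    (hn : Algebra.etrdeg k A ≤ n) :
    P.height + Algebra.etrdeg k (_ ⧸ P) ≤
      n + (polyIdeal (P.comap (Algebra.TensorProduct.includeRight : B →ₐ[k] A ⊗[k] B)) n).height +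
        Algebra.etrdeg k (B ⧸ P.comap (Algebra.TensorProduct.includeRight : B →ₐ[k] A ⊗[k] B)) := by
  refine ENat.add_le_of_forall_natCast fun m hm ↦ ?_
  rw [add_comm]
  refine ENat.add_le_of_forall_natCast fun h hh ↦ ?_
  obtain ⟨S, hS, hSP⟩ := Algebra.TensorProduct.exists_fg_forall_le_height_comap P hh
  obtain ⟨T, hT, hTP⟩ := Algebra.TensorProduct.exists_fg_forall_le_etrdeg_comap P hm
  have : Algebra.FiniteType k (S ⊔ T : Subalgebra k A) :=
    (Subalgebra.fg_iff_finiteType _).1 (hS.sup hT)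
  have hb := Algebra.TensorProduct.height_add_etrdeg_le_of_finiteType
    (P.comap (Algebra.TensorProduct.map (S ⊔ T).val (AlgHom.id k B))) (n := n)
    ((Algebra.etrdeg_le_of_injective (S ⊔ T).val Subtype.val_injective).trans hn)
  have hc : (P.comap (Algebra.TensorProduct.map (S ⊔ T).val (AlgHom.id k B))).comap
      (Algebra.TensorProduct.includeRight : B →ₐ[k] (S ⊔ T : Subalgebra k A) ⊗[k] B) =
      P.comap (Algebra.TensorProduct.includeRight : B →ₐ[k] A ⊗[k] B) := by
    ext b
    simp [Ideal.mem_comap]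
  rw [hc] at hb
  rw [add_comm]
  exact (add_le_add (hSP _ le_sup_left) (hTP _ le_sup_right)).trans hb

end UpperBound

/-! ### Lower bounds from flatness over a polynomial ring. -/

section LowerBound

variable {k : Type*} [Field k]

theorem RingHom.Flat.of_injective_of_isDomain {R K : Type*} [CommRing R] [IsDomain R] [Field K]
    {f : R →+* K} (hf : Function.Injective f) : f.Flat := by
  algebraize [f]
  have : FaithfulSMul R K := (faithfulSMul_iff_algebraMap_injective R K).2 hf
  let : Algebra (FractionRing R) K := FractionRing.liftAlgebra R K
  have : IsScalarTower R (FractionRing R) K := FractionRing.isScalarTower_liftAlgebra R K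
  have : Module.Flat R (FractionRing R) := IsLocalization.flat _ (nonZeroDivisors R)
  exact Module.Flat.trans R (FractionRing R) K

variable {A B : Type*} [CommRing A] [Algebra k A] [CommRing B] [Algebra k B]

/-- Contraction to a polynomial ring does not increase the height of primes of `A ⊗ B` that lie
over the zero ideal of the domain `A`. -/
theorem MvPolynomial.height_comap_toTensor_le [IsDomain A] {n : ℕ}
    {g : MvPolynomial (Fin n) k →ₐ[k] A} (hg : Function.Injective g)
    (P : Ideal (A ⊗[k] B)) [P.IsPrime]
    (hP : P.comap (Algebra.TensorProduct.includeLeft : A →ₐ[k] A ⊗[k] B) = ⊥) :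
    (P.comap (toTensor B g)).height ≤ P.height := by
  -- A need not be flat over k[X₁, …, Xₙ], but F is. Since P lies over 0, it survives in the
  -- localization F ⊗ B with the same height.
  let F := FractionRing A
  let ι : A →ₐ[k] F := IsScalarTower.toAlgHom k A F
  let φ : A ⊗[k] B →ₐ[k] F ⊗[k] B := Algebra.TensorProduct.map ι (AlgHom.id k B)
  algebraize [φ.toRingHom]
  have hφ (z : A ⊗[k] B) : algebraMap (A ⊗[k] B) (F ⊗[k] B) z = φ z := rfl
  have : IsScalarTower A (A ⊗[k] B) (F ⊗[k] B) := .of_algebraMap_eq fun a ↦ by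
    rw [hφ]
    simp [φ, ι, Algebra.TensorProduct.algebraMap_apply, IsScalarTower.algebraMap_apply A F (F ⊗[k] B)]
  let M := Algebra.algebraMapSubmonoid (A ⊗[k] B) (nonZeroDivisors A)
  have hM : IsLocalization M (F ⊗[k] B) :=
    IsLocalization.tensorProduct_tensorProduct k B (nonZeroDivisors A) F (by
      ext b
      simp [hφ, φ])
  have hd : Disjoint (M : Set (A ⊗[k] B)) P := by
    refine Set.disjoint_left.2 ?_
    rintro _ ⟨a, ha, rfl⟩ haP
    have : a ∈ P.comap (Algebra.TensorProduct.includeLeft : A →ₐ[k] A ⊗[k] B) := haP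
    rw [hP, Ideal.mem_bot] at this
    exact nonZeroDivisors.ne_zero ha this
  have : (P.map (algebraMap (A ⊗[k] B) (F ⊗[k] B))).IsPrime :=
    IsLocalization.isPrime_of_isPrime_disjoint M _ P ‹_› hd
  have hcomp : toTensor B (ι.comp g) = φ.comp (toTensor B g) := by
    rw [toTensor, toTensor, ← AlgHom.comp_assoc]
    congr 1
    ext <;> simp [φ]
  have hflat : (toTensor B (ι.comp g)).Flat := flat_toTensor _
    (RingHom.Flat.of_injective_of_isDomain (f := (ι.comp g).toRingHom)
      ((IsFractionRing.injective A F).comp hg))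
  have h1 := hflat.height_comap_le (P.map (algebraMap (A ⊗[k] B) (F ⊗[k] B)))
  rw [IsLocalization.height_map_of_disjoint M P hd] at h1
  convert! h1 using 2
  rw [hcomp]
  change _ = ((P.map (algebraMap (A ⊗[k] B) (F ⊗[k] B))).under (A ⊗[k] B)).comap (toTensor B g)
  rw [IsLocalization.under_map_of_isPrime_disjoint M _ ‹_› hd]

namespace TensorProduct

theorem height_polyIdeal_le [IsDomain A] {n : ℕ} (hn : (n : ℕ∞) ≤ Algebra.etrdeg k A)
    (P : Ideal (A ⊗[k] B)) [P.IsPrime]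
    (hP : P.comap (Algebra.TensorProduct.includeLeft : A →ₐ[k] A ⊗[k] B) = ⊥) :
    (polyIdeal (P.comap (Algebra.TensorProduct.includeRight : B →ₐ[k] A ⊗[k] B)) n).height ≤
      P.height := by
  obtain ⟨x, hx⟩ := Algebra.natCast_le_etrdeg_iff.1 hn
  refine le_trans (Ideal.height_mono ?_) (MvPolynomial.height_comap_toTensor_le hx P hP)
  rw [polyIdeal, Ideal.map_le_iff_le_comap, MvPolynomial.comap_toTensor_comap_C]

theorem add_etrdeg_le_height_add [IsDomain A] {n : ℕ} (hn : (n : ℕ∞) ≤ Algebra.etrdeg k A)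
    (P : Ideal (A ⊗[k] B)) [P.IsPrime]
    (hP : P.comap (Algebra.TensorProduct.includeLeft : A →ₐ[k] A ⊗[k] B) = ⊥) :
    n + Algebra.etrdeg k
        (B ⧸ P.comap (Algebra.TensorProduct.includeRight : B →ₐ[k] A ⊗[k] B)) ≤
      P.height + Algebra.etrdeg k (_ ⧸ P) := by
  obtain ⟨x, hx⟩ := Algebra.natCast_le_etrdeg_iff.1 hn
  have h1 := MvPolynomial.add_etrdeg_le_height_add (k := k) n
    (P.comap (MvPolynomial.toTensor B (MvPolynomial.aeval x)))
  rw [MvPolynomial.comap_toTensor_comap_C] at h1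
  exact h1.trans (add_le_add (MvPolynomial.height_comap_toTensor_le hx P hP)
    (Ideal.etrdeg_quotient_comap_le _ P))

theorem ker_map_id_mk (q : Ideal B) :
    RingHom.ker (Algebra.TensorProduct.map (AlgHom.id k A) (Ideal.Quotient.mkₐ k q)) =
      q.map (Algebra.TensorProduct.includeRight : B →ₐ[k] A ⊗[k] B) := by
  refine (Algebra.TensorProduct.map_ker _ _ Function.surjective_id
    (Ideal.Quotient.mkₐ_surjective k q)).trans ?_
  have h1 : RingHom.ker (AlgHom.id k A) = ⊥ := (RingHom.injective_iff_ker_eq_bot _).1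
    Function.injective_id
  have h2 : RingHom.ker (Ideal.Quotient.mkₐ k q) = q := Ideal.Quotient.mkₐ_ker k q
  rw [h1, h2, Ideal.map_bot, bot_sup_eq]

theorem ker_map_mk_mk (p : Ideal A) (q : Ideal B) :
    RingHom.ker (Algebra.TensorProduct.map (Ideal.Quotient.mkₐ k p) (Ideal.Quotient.mkₐ k q)) =
      tensorSumIdeal k p q := by
  refine (Algebra.TensorProduct.map_ker _ _ (Ideal.Quotient.mkₐ_surjective k p)
    (Ideal.Quotient.mkₐ_surjective k q)).trans ?_
  have h1 : RingHom.ker (Ideal.Quotient.mkₐ k p) = p := Ideal.Quotient.mkₐ_ker k p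
  have h2 : RingHom.ker (Ideal.Quotient.mkₐ k q) = q := Ideal.Quotient.mkₐ_ker k q
  rw [h1, h2, tensorSumIdeal]

/-- A minimal prime over `A ⊗ q` lies over the zero ideal of the domain `A`. -/
theorem comap_includeLeft_eq_bot_of_mem_minimalPrimes [IsDomain A] {q : Ideal B}
    {N : Ideal (A ⊗[k] B)}
    (hN : N ∈ (q.map (Algebra.TensorProduct.includeRight : B →ₐ[k] A ⊗[k] B)).minimalPrimes) :
    N.comap (Algebra.TensorProduct.includeLeft : A →ₐ[k] A ⊗[k] B) = ⊥ := by
  let f : A ⊗[k] B →ₐ[k] A ⊗[k] (B ⧸ q) :=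
    Algebra.TensorProduct.map (AlgHom.id k A) (Ideal.Quotient.mkₐ k q)
  have hf : Function.Surjective f := Algebra.TensorProduct.map_surjective _ _
    Function.surjective_id (Ideal.Quotient.mkₐ_surjective k q)
  have hker : RingHom.ker f = q.map Algebra.TensorProduct.includeRight := ker_map_id_mk q
  have hNp : N.IsPrime := hN.1.1
  have hNk : RingHom.ker f ≤ N := hker.trans_le hN.1.2
  have hNm : (N.map f.toRingHom).IsPrime := Ideal.map_isPrime_of_surjective hf hNk
  have hcm : (N.map f.toRingHom).comap f.toRingHom = N := Ideal.comap_map_eq_of_ker_le hf hNk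
  -- Going-down for the flat map A → A ⊗ (B/q) finds a prime over 0 below the image of N; minimality
  -- of N then forces N inside its preimage.
  obtain ⟨Q, hQN, hQ, hQ0⟩ := Ideal.exists_ideal_le_liesOver_of_le (p := (⊥ : Ideal A))
    (q := (N.map f.toRingHom).under A) (N.map f.toRingHom) bot_le
  have hNQ : N ≤ Q.comap f.toRingHom := hN.2
    ⟨inferInstance, hker.symm.trans_le (Ideal.ker_le_comap f.toRingHom)⟩
    ((Ideal.comap_mono hQN).trans_eq hcm)
  refine le_bot_iff.1 fun a ha ↦ ?_
  rw [hQ0.over, Ideal.mem_comap]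
  have : f (a ⊗ₜ 1) ∈ Q := hNQ ha
  simpa [f, Algebra.TensorProduct.algebraMap_apply] using this

/-- Flatness of A ⊗ (B/q) over A gives a chain of length ht p above A ⊗ q. Below any prime of that
chain sits a minimal prime over A ⊗ q; it lies over 0 in A and over q in B, so its height is at
least ht q[n]. -/
theorem height_polyIdeal_add_height_le [IsDomain A] {n : ℕ} (hn : (n : ℕ∞) ≤ Algebra.etrdeg k A)
    (P : Ideal (A ⊗[k] B)) [P.IsPrime] :
    (polyIdeal (P.comap (Algebra.TensorProduct.includeRight : B →ₐ[k] A ⊗[k] B)) n).height +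
      (P.comap (Algebra.TensorProduct.includeLeft : A →ₐ[k] A ⊗[k] B)).height ≤ P.height := by
  set q := P.comap (Algebra.TensorProduct.includeRight : B →ₐ[k] A ⊗[k] B) with hq
  let f : A ⊗[k] B →ₐ[k] A ⊗[k] (B ⧸ q) :=
    Algebra.TensorProduct.map (AlgHom.id k A) (Ideal.Quotient.mkₐ k q)
  have hf : Function.Surjective f.toRingHom := Algebra.TensorProduct.map_surjective _ _
    Function.surjective_id (Ideal.Quotient.mkₐ_surjective k q)
  have hker : RingHom.ker f.toRingHom = q.map Algebra.TensorProduct.includeRight := ker_map_id_mk q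
  have hPk : RingHom.ker f.toRingHom ≤ P := hker.trans_le Ideal.map_comap_le
  have hPm : (P.map f.toRingHom).IsPrime := Ideal.map_isPrime_of_surjective hf hPk
  have hp : P.comap (Algebra.TensorProduct.includeLeft : A →ₐ[k] A ⊗[k] B) =
      (P.map f.toRingHom).comap (algebraMap A (A ⊗[k] (B ⧸ q))) := by
    conv_lhs => rw [← Ideal.comap_map_eq_of_ker_le hf hPk]
    ext a
    simp [Ideal.mem_comap, f, Algebra.TensorProduct.algebraMap_apply]
  have hflat : (algebraMap A (A ⊗[k] (B ⧸ q))).Flat :=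
    RingHom.flat_algebraMap_iff.2 inferInstance
  have h1 := hflat.height_comap_le (P.map f.toRingHom)
  rw [← hp] at h1
  refine (add_le_add_right h1 _).trans (Ideal.add_height_map_le_of_surjective hf hPk ?_)
  intro M hM hkM hMP
  rw [hker] at hkM
  obtain ⟨N, hN, hNM⟩ := Ideal.exists_minimalPrimes_le hkM
  have hNp : N.IsPrime := hN.1.1
  have hNq : N.comap (Algebra.TensorProduct.includeRight : B →ₐ[k] A ⊗[k] B) = q :=
    le_antisymm (Ideal.comap_mono (hNM.trans hMP)) (Ideal.map_le_iff_le_comap.1 hN.1.2)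
  have := height_polyIdeal_le hn N (comap_includeLeft_eq_bot_of_mem_minimalPrimes hN)
  rw [hNq] at this
  exact this.trans (Ideal.height_mono hNM)

theorem height_polyIdeal_add_height_add_height_le [IsDomain A] {n : ℕ}
    (hn : (n : ℕ∞) ≤ Algebra.etrdeg k A) (P : Ideal (A ⊗[k] B)) [P.IsPrime] {p : Ideal A}
    (hp : p = P.comap (Algebra.TensorProduct.includeLeft : A →ₐ[k] A ⊗[k] B)) {q : Ideal B}
    (hq : q = P.comap (Algebra.TensorProduct.includeRight : B →ₐ[k] A ⊗[k] B)) :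
    (polyIdeal q n).height + p.height +
      (P.map (Ideal.Quotient.mk (tensorSumIdeal k p q))).height ≤ P.height := by
  have hI {M : Ideal (A ⊗[k] B)} : tensorSumIdeal k p q ≤ M ↔
      p ≤ M.comap (Algebra.TensorProduct.includeLeft : A →ₐ[k] A ⊗[k] B) ∧
        q ≤ M.comap (Algebra.TensorProduct.includeRight : B →ₐ[k] A ⊗[k] B) := by
    rw [tensorSumIdeal, sup_le_iff, Ideal.map_le_iff_le_comap, Ideal.map_le_iff_le_comap]
  refine Ideal.add_height_map_le_of_surjective Ideal.Quotient.mk_surjective ?_ ?_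
  · rw [Ideal.mk_ker]
    exact hI.2 ⟨hp.le, hq.le⟩
  -- Every prime between I and P contracts to exactly p and q, so the two-term bound holds for it
  -- with the same p and q.
  · intro M hM hkM hMP
    rw [Ideal.mk_ker, hI] at hkM
    have := height_polyIdeal_add_height_le hn M
    rwa [← le_antisymm hkM.1 ((Ideal.comap_mono hMP).trans hp.ge),
      ← le_antisymm hkM.2 ((Ideal.comap_mono hMP).trans hq.ge)] at this

theorem etrdeg_add_etrdeg_le (P : Ideal (A ⊗[k] B)) [P.IsPrime] {p : Ideal A}
    (hp : p = P.comap (Algebra.TensorProduct.includeLeft : A →ₐ[k] A ⊗[k] B)) {q : Ideal B}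
    (hq : q = P.comap (Algebra.TensorProduct.includeRight : B →ₐ[k] A ⊗[k] B)) :
    Algebra.etrdeg k (B ⧸ q) + Algebra.etrdeg k (A ⧸ p) ≤
      (P.map (Ideal.Quotient.mk (tensorSumIdeal k p q))).height + Algebra.etrdeg k (_ ⧸ P) := by
  -- Here n is any finite lower bound for t.d.(A/p), which is not assumed finite.
  refine ENat.add_le_of_forall_natCast fun n hn ↦ ?_
  let f : A ⊗[k] B →ₐ[k] (A ⧸ p) ⊗[k] (B ⧸ q) :=
    Algebra.TensorProduct.map (Ideal.Quotient.mkₐ k p) (Ideal.Quotient.mkₐ k q)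
  have hf : Function.Surjective f.toRingHom := Algebra.TensorProduct.map_surjective _ _
    (Ideal.Quotient.mkₐ_surjective k p) (Ideal.Quotient.mkₐ_surjective k q)
  have hker : RingHom.ker f.toRingHom = tensorSumIdeal k p q := ker_map_mk_mk p q
  have hPk : RingHom.ker f.toRingHom ≤ P := by
    rw [hker, tensorSumIdeal, sup_le_iff, Ideal.map_le_iff_le_comap, Ideal.map_le_iff_le_comap]
    exact ⟨hp.le, hq.le⟩
  have hPm : (P.map f.toRingHom).IsPrime := Ideal.map_isPrime_of_surjective hf hPk
  have hcm : (P.map f.toRingHom).comap f.toRingHom = P := Ideal.comap_map_eq_of_ker_le hf hPk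
  have hpp : p.IsPrime := by rw [hp]; infer_instance
  have hA : (P.map f.toRingHom).comap
      (Algebra.TensorProduct.includeLeft : A ⧸ p →ₐ[k] (A ⧸ p) ⊗[k] (B ⧸ q)) = ⊥ := by
    refine le_bot_iff.1 fun a ha ↦ ?_
    obtain ⟨a, rfl⟩ := Ideal.Quotient.mk_surjective a
    have : a ⊗ₜ 1 ∈ (P.map f.toRingHom).comap f.toRingHom := by
      simpa [f, Ideal.mem_comap] using ha
    rw [hcm] at this
    rw [Ideal.mem_bot, Ideal.Quotient.eq_zero_iff_mem, hp]
    exact this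
  have hB : (P.map f.toRingHom).comap
      (Algebra.TensorProduct.includeRight : B ⧸ q →ₐ[k] (A ⧸ p) ⊗[k] (B ⧸ q)) = ⊥ := by
    refine le_bot_iff.1 fun b hb ↦ ?_
    obtain ⟨b, rfl⟩ := Ideal.Quotient.mk_surjective b
    have : 1 ⊗ₜ b ∈ (P.map f.toRingHom).comap f.toRingHom := by
      simpa [f, Ideal.mem_comap] using hb
    rw [hcm] at this
    rw [Ideal.mem_bot, Ideal.Quotient.eq_zero_iff_mem, hq]
    exact this
  have h1 := add_etrdeg_le_height_add hn (P.map f.toRingHom) hA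
  have h2 : Algebra.etrdeg k (_ ⧸ (P.map f.toRingHom).comap f) =
      Algebra.etrdeg k (_ ⧸ P.map f.toRingHom) :=
    Ideal.etrdeg_quotient_comap_eq_of_isIntegral f (RingHom.isIntegral_of_surjective _ hf) _
  have h3 : (P.map f.toRingHom).comap f = P := hcm
  have h4 : Algebra.etrdeg k ((B ⧸ q) ⧸ (⊥ : Ideal (B ⧸ q))) = Algebra.etrdeg k (B ⧸ q) :=
    (AlgEquiv.quotientBot k (B ⧸ q)).etrdeg_eq
  rw [hB, h4, ← h2, h3, ← Ideal.height_map_quotient_mk_ker hf, hker] at h1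
  rwa [add_comm]

end TensorProduct

end LowerBound

/-! ### Combination of the three inequalities. -/

theorem proposition2p5 {k A B : Type*} [Field k] [CommRing A] [Algebra k A]
    [CommRing B] [Algebra k B]
    (hA_fin : Algebra.trdeg k A < Cardinal.aleph0) (hB_fin : Algebra.trdeg k B < Cardinal.aleph0)
    (hA : IsAFDomain k A) (P : Ideal (A ⊗[k] B)) (hP : P.IsPrime)
    (p : Ideal A)
    (hp : p = P.comap (Algebra.TensorProduct.includeLeft : A →ₐ[k] A ⊗[k] B))
    (q : Ideal B)
    (hq : q = P.comap (Algebra.TensorProduct.includeRight : B →ₐ[k] A ⊗[k] B)) :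
    P.height =
      (polyIdeal q (Cardinal.toNat (Algebra.trdeg k A))).height + p.height +
        (P.map (Ideal.Quotient.mk (tensorSumIdeal k p q))).height := by
  have := hA.isDomain
  set n := Cardinal.toNat (Algebra.trdeg k A)
  have hn : Algebra.etrdeg k A = n := by
    rw [Algebra.etrdeg, ← Cardinal.cast_toNat_of_lt_aleph0 hA_fin, Cardinal.toENat_nat]
  have hpp : p.IsPrime := by rw [hp]; infer_instance
  have hlow := TensorProduct.height_polyIdeal_add_height_add_height_le hn.ge P hp hq
  have hup := Algebra.TensorProduct.height_add_etrdeg_le P hn.le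
  have hfib := TensorProduct.etrdeg_add_etrdeg_le P hp hq
  have haf : p.height + Algebra.etrdeg k (A ⧸ p) = n := (hA.altitude_formula p hpp).trans hn
  have hBq : Algebra.etrdeg k (B ⧸ q) ≠ ⊤ := by
    refine ((Algebra.etrdeg_le_of_surjective (Ideal.Quotient.mkₐ k q)
      (Ideal.Quotient.mkₐ_surjective k q)).trans_lt ?_).ne
    exact Cardinal.toENat_lt_top.2 hB_fin
  rw [← hq] at hup
  refine le_antisymm ?_ hlow
  -- If ht q[n] is infinite the right side is ⊤. Otherwise the upper bound makes t.d.((A ⊗ B)/P)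
  -- finite, hence cancellable in `ℕ∞`.
  by_cases htop : (polyIdeal q n).height = ⊤
  · simp [htop]
  have htau : Algebra.etrdeg k (_ ⧸ P) ≠ ⊤ := by
    refine (lt_of_le_of_lt (le_add_self.trans hup) ?_).ne
    simp [lt_top_iff_ne_top, htop, hBq]
  rw [← ENat.add_le_add_iff_right htau]
  calc P.height + Algebra.etrdeg k (_ ⧸ P) ≤ _ := hup
    _ = (polyIdeal q n).height + p.height +
        (Algebra.etrdeg k (B ⧸ q) + Algebra.etrdeg k (A ⧸ p)) := by rw [← haf]; ring
    _ ≤ _ := by rw [add_assoc _ (Ideal.height _) (Algebra.etrdeg _ _)]; gcongr
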